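/- Let $\mathcal Z$ be a nonempty compact metric space (for instance the unit sphere $\mathbb S^{d-1}\subset\mathbb R^d$, $d\ge 1$), equipped with its Borel $\sigma$-algebra, and let $u:\mathcal Z\times\mathcal Z\to\mathbb R$ be continuous (hence bounded and measurable). Consider the two-player zero-sum game in which player 1 receives $u(z_1,z_2)$ and player 2 receives $-u(z_1,z_2)$; for Borel probability measures $\mu,\nu$ on $\mathcal Z$ (mixed strategies) put $u(\mu,\nu)=\int u\,d(\mu\otimes\nu)$, and write $u(z,\nu)=u(\delta_z,\nu)$, $u(\mu,z)=u(\mu,\delta_z)$. A pair $(\mu,\nu)$ is an $\varepsilon$-Nash equilibrium if $u(\mu,\nu)\ge u(\mu',\nu)-\varepsilon$ and $-u(\mu,\nu)\ge -u(\mu,\nu')-\varepsilon$ for all mixed strategies $\mu',\nu'$. Approximate fictitious play (the abstraction of the LS-NFSP updates): sequences $(z_1^t,z_2^t)_{t\ge1}$ in $\mathcal Z\times\mathcal Z$ with errors $\epsilon_1^t,\epsilon_2^t\ge0$ such that, with $\bar\mu_t=\frac1t\sum_{s=1}^{t}\delta_{z_1^s}$ and $\bar\nu_t=\frac1t\sum_{s=1}^{t}\delta_{z_2^s}$,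 for all $t\ge2$ $$u(z_1^t,\bar\nu_{t-1})\ge\max_{z\in\mathcal Z}u(z,\bar\nu_{t-1})-\epsilon_1^t,\qquad u(\bar\mu_{t-1},z_2^t)\le\min_{z\in\mathcal Z}u(\bar\mu_{t-1},z)+\epsilon_2^t .$$ The initial strategies $z_1^1,z_2^1$ are arbitrary. Let $E_T=\frac1T\sum_{t=1}^T(\epsilon_1^t+\epsilon_2^t)$ be the average error. Then: 1. The mixed payoff $u(\mu,\nu)$ is well defined (the integrand is integrable) for all mixed strategies $\mu,\nu$; the game has a value, $\max_\mu\min_\nu u(\mu,\nu)=\min_\nu\max_\mu u(\mu,\nu)$, with the maximum and minimum attained; and it has a Nash equilibrium in mixed strategies. 2. (Convergence up to the approximation error.) There is a function $\omega:\mathbb R\to\mathbb R$, depending only on the game, with $\omega(\delta)\to0=\omega(0)$ as $\delta\downarrow0$, such that for all $\delta\ge0$ and $\eta>0$ there is $T_0$ with the following property: for every approximate fictitious play and every $T\ge T_0$ with $E_T\le\delta$, the pair $(\bar\mu_T,\bar\nu_T)$ is an $(\omega(\delta)+\eta)$-Nash equilibrium. 3. In particular, if $E_T\to0$, then for every $\varepsilon>0$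 the pair $(\bar\mu_T,\bar\nu_T)$ is an $\varepsilon$-Nash equilibrium for all sufficiently large $T$. -/

import Mathlib

open MeasureTheory Filter Topology

noncomputable section

namespace LatentGame

variable {Z : Type*} [MeasurableSpace Z]

/-- Expected payoff to player 1 when the two players independently use the mixed strategies
`μ` and `ν`; player 2 receives the negative of it. -/
def mixedPayoff (u : Z → Z → ℝ) (μ ν : Measure Z) : ℝ :=
  ∫ p, u p.1 p.2 ∂(μ.prod ν)

/-- `(μ, ν)` is an `ε`-Nash equilibrium, in mixed strategies, of the zero-sum game with
payoff `u` to player 1 and `-u` to player 2: no player gains more than `ε` by a unilateral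
deviation. -/
structure IsApproxNash (u : Z → Z → ℝ) (ε : ℝ) (μ ν : Measure Z) : Prop where
  prob₁ : IsProbabilityMeasure μ
  prob₂ : IsProbabilityMeasure ν
  dev₁ : ∀ μ' : Measure Z, IsProbabilityMeasure μ' →
    mixedPayoff u μ ν ≥ mixedPayoff u μ' ν - ε
  dev₂ : ∀ ν' : Measure Z, IsProbabilityMeasure ν' →
    -mixedPayoff u μ ν ≥ -mixedPayoff u μ ν' - ε

/-- `V` is the value of the mixed extension: both
`max_μ min_ν u(μ, ν)` and `min_ν max_μ u(μ, ν)` are attained and equal to `V`. -/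
def IsValue (u : Z → Z → ℝ) (V : ℝ) : Prop :=
  (∃ μ : Measure Z, IsProbabilityMeasure μ ∧
    ∀ ν : Measure Z, IsProbabilityMeasure ν → V ≤ mixedPayoff u μ ν) ∧
  (∃ ν : Measure Z, IsProbabilityMeasure ν ∧
    ∀ μ : Measure Z, IsProbabilityMeasure μ → mixedPayoff u μ ν ≤ V)

/-- Empirical distribution of the first `T` strategies `z 0, …, z (T - 1)`
(a probability measure for `T ≥ 1`). -/
def empirical (z : ℕ → Z) (T : ℕ) : Measure Z :=
  (T : ENNReal)⁻¹ • ∑ t ∈ Finset.range T, Measure.dirac (z t)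

/-- Approximate fictitious play: each new strategy is, up to the nonnegative error of that
iteration, a best response to the empirical distribution of the opponent's past strategies.
The initial strategies `z₁ 0`, `z₂ 0` are arbitrary. -/
structure IsApproxFictitiousPlay (u : Z → Z → ℝ) (z₁ z₂ : ℕ → Z) (e₁ e₂ : ℕ → ℝ) : Prop where
  err₁_nonneg : ∀ t, 0 ≤ e₁ t
  err₂_nonneg : ∀ t, 0 ≤ e₂ t
  response₁ : ∀ t, 1 ≤ t → ∀ z : Z,
    mixedPayoff u (Measure.dirac (z₁ t)) (empirical z₂ t) ≥
      mixedPayoff u (Measure.dirac z) (empirical z₂ t) - e₁ t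
  response₂ : ∀ t, 1 ≤ t → ∀ z : Z,
    mixedPayoff u (empirical z₁ t) (Measure.dirac (z₂ t)) ≤
      mixedPayoff u (empirical z₁ t) (Measure.dirac z) + e₂ t

/-- The average over the first `T` iterations of the total best-response error. -/
def averageError (e₁ e₂ : ℕ → ℝ) (T : ℕ) : ℝ :=
  (∑ t ∈ Finset.range T, (e₁ t + e₂ t)) / (T : ℝ)

end LatentGame

end

/-!
The duality gap of a pair of mixed strategies is the largest payoff of a pure strategy against the
second one minus the smallest payoff of a pure strategy of player 2 against the first one; a gap of
at most `ε` makes the pair an `ε`-equilibrium (`isApproxNash_of_gap_le`). Everything follows from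
`exists_gap_le`: for every `ε` there are `δ > 0` and `T₀` such that at every time `T ≥ T₀` with
average error at most `δ`, the gap of the empirical distributions is at most `ε`, whatever the play.

Multiplied by the time `t`, the two terms of the gap are the cumulative payoffs `M t` of the best
constant strategy of player 1 and `m t` of the best constant strategy of player 2, with
`M 0 = m 0 = 0`. In continuous time the envelope theorem gives `M' = m' =` the current payoff, so
that `M - m` stays zero. The discrete argument is a quantitative form of this.
By compactness, finitely many constant strategies describe the payoff up to `κ`. Their cumulative
payoffs and `M`, `m` are finitely many sequences with bounded increments. If `M T - m T ≥ ε * T`,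
there is a window of a length proportional to `T` on which all of them are almost affine and `M`
grows faster than `m` at a rate of at least `ε / 2` (`exists_isAffineWindow`). This holds because
rescaled limits along an ultrafilter are Lipschitz, hence almost everywhere differentiable and
integrals of their derivatives. On a much shorter block inside the window, every strategy that
player 1 uses earns almost the slope of `M`, since it is nearly optimal in the block and not better
than optimal at the two distant ends (`IsApproxResponse.abs_cumulativePayoff_sub_slope_le`);
the errors spread over the block are small because their average is. Hence
the total payoff between the two blocks of strategies is the squared block length times the slope
of `M`, and, by symmetry, also times the slope of `m` (`IsApproxResponse.abs_sum_block_sub_le`),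
which contradicts the difference of the slopes.

An exact equilibrium, and with it the value, is a weak limit point of the empirical distributions
of exact fictitious play, by compactness of the space of probability measures. The function `ω` is
`errorFloor`, the best accuracy guaranteed in the long run by an average error of at most `δ`.
-/

/-! ### Windows on which finitely many Lipschitz sequences are almost affine -/

/-- On the time points `a₀ < a < b < b₁` every sequence of the family `A` is, relative to its value
at `a` and up to an error `κ` per unit of time, affine with slope `p i`. The block `[a, b)` has
length at least `r * T`, and is shorter by the factor `κ` than the intervals `[a₀, a]` and
`[a, b₁]` around it. -/
structure IsAffineWindow {ι : Type*} (A : ι → ℕ → ℝ) (p : ι → ℝ) (κ r : ℝ) (T a₀ a b b₁ : ℕ) :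
    Prop where
  le_horizon : b ≤ T
  length_ge : r * T ≤ (b : ℝ) - a
  length_le_left : (b : ℝ) - a ≤ κ * ((a : ℝ) - a₀)
  length_le_right : (b : ℝ) - a ≤ κ * ((b₁ : ℝ) - a)
  left : ∀ i, |A i a₀ - A i a + ((a : ℝ) - a₀) * p i| ≤ κ * ((a : ℝ) - a₀)
  block : ∀ i, |A i b - A i a - ((b : ℝ) - a) * p i| ≤ κ * ((b : ℝ) - a)
  right : ∀ i, |A i b₁ - A i a - ((b₁ : ℝ) - a) * p i| ≤ κ * ((b₁ : ℝ) - a)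

theorem abs_sub_le_of_abs_succ_sub_le {A : ℕ → ℝ} {C : ℝ} (h : ∀ l, |A (l + 1) - A l| ≤ C)
    {a b : ℕ} (hab : a ≤ b) : |A b - A a| ≤ C * ((b : ℝ) - a) := by
  induction b, hab using Nat.le_induction with
  | base => simp
  | succ n hn ih =>
    have := abs_sub_le (A (n + 1)) (A n) (A a)
    have := h n
    push_cast
    linarith

/-- Sequences `A n` with increments bounded by `C`, rescaled by `T n` in time and in space, have a
Lipschitz limit along an ultrafilter. -/
theorem exists_rescaled_limit (U : Ultrafilter ℕ) {T : ℕ → ℕ} (hT : Tendsto T U atTop)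
    {A : ℕ → ℕ → ℝ} {C : ℝ} (hC : 0 ≤ C) (hA₀ : ∀ n, A n 0 = 0)
    (hA : ∀ n l, |A n (l + 1) - A n l| ≤ C) :
    ∃ f : ℝ → ℝ, LipschitzWith C.toNNReal f ∧ f 0 = 0 ∧
      ∀ s : ℝ, Tendsto (fun n => A n ⌊s * T n⌋₊ / T n) U (𝓝 (f s)) := by
  have hbound : ∀ s : ℝ, ∀ n, A n ⌊s * T n⌋₊ / T n ∈ Set.Icc (-(C * |s|)) (C * |s|) := by
    intro s n
    rw [Set.mem_Icc, ← abs_le, abs_div, Nat.abs_cast]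
    have h1 := abs_sub_le_of_abs_succ_sub_le (hA n) (Nat.zero_le ⌊s * T n⌋₊)
    rw [hA₀, sub_zero] at h1
    have h2 : ((⌊s * T n⌋₊ : ℕ) : ℝ) ≤ |s| * T n :=
      (Nat.cast_le.2 (Nat.floor_mono (by gcongr; exact le_abs_self s))).trans
        (Nat.floor_le (by positivity))
    apply div_le_of_le_mul₀ (by positivity) (by positivity)
    calc _ ≤ _ := h1
      _ ≤ C * (|s| * T n) := by gcongr; simpa using h2
      _ = _ := by ring
  have hlim : ∀ s : ℝ, ∃ x, Tendsto (fun n => A n ⌊s * T n⌋₊ / T n) U (𝓝 x) := by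
    intro s
    obtain ⟨x, -, hx⟩ := (isCompact_Icc (a := -(C * |s|)) (b := C * |s|)).ultrafilter_le_nhds
      (U.map fun n => A n ⌊s * T n⌋₊ / T n)
      (le_principal_iff.2 (Filter.Eventually.of_forall (f := (U : Filter ℕ)) (hbound s)))
    exact ⟨x, hx⟩
  choose f hf using hlim
  refine ⟨f, ?_, ?_, hf⟩
  · have key : ∀ s t : ℝ, s ≤ t → |f t - f s| ≤ C * (t - s) := by
      intro s t hst
      have h1 : Tendsto (fun n => C * (t - s) + C * (1 / (T n : ℝ))) U (𝓝 (C * (t - s) + C * 0)) :=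
        (((tendsto_one_div_atTop_nhds_zero_nat (𝕜 := ℝ)).comp hT).const_mul C).const_add _
      rw [mul_zero, add_zero] at h1
      refine le_of_tendsto_of_tendsto ((hf t).sub (hf s)).abs h1 ?_
      filter_upwards [hT.eventually_ge_atTop 1] with n hn
      have hn' : (0 : ℝ) < T n := by exact_mod_cast hn
      have hfl : ⌊s * T n⌋₊ ≤ ⌊t * T n⌋₊ := Nat.floor_mono (by gcongr)
      have h2 := abs_sub_le_of_abs_succ_sub_le (hA n) hfl
      have h3 : ((⌊t * T n⌋₊ : ℕ) : ℝ) - (⌊s * T n⌋₊ : ℕ) ≤ (t - s) * T n + 1 := by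
        have h4 := Nat.lt_floor_add_one (s * T n)
        rcases le_or_gt 0 (t * T n) with h | h
        · have := Nat.floor_le h
          linarith
        · have h5 : ⌊t * T n⌋₊ = 0 := Nat.floor_of_nonpos h.le
          have h6 : 0 ≤ (t - s) * T n := mul_nonneg (by linarith) hn'.le
          rw [h5]
          have : (0 : ℝ) ≤ (⌊s * T n⌋₊ : ℕ) := by positivity
          push_cast
          linarith
      rw [← sub_div, abs_div, Nat.abs_cast, div_le_iff₀ hn']
      calc _ ≤ _ := h2
        _ ≤ C * ((t - s) * T n + 1) := by gcongr
        _ = _ := by field_simp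
    refine LipschitzWith.of_dist_le_mul fun s t => ?_
    rw [Real.dist_eq, Real.dist_eq, Real.coe_toNNReal C hC]
    rcases le_total s t with h | h
    · rw [abs_sub_comm, abs_sub_comm s t, abs_of_nonneg (sub_nonneg.2 h)]
      exact key s t h
    · rw [abs_of_nonneg (sub_nonneg.2 h)]
      exact key t s h
  · refine tendsto_nhds_unique (hf 0) ?_
    simp [hA₀]

/-- Rademacher's theorem and the fundamental theorem of calculus: Lipschitz functions are jointly
differentiable at a point where the derivative of `f i₁ - f i₂` is not much smaller than its mean
over `[0, 1]`. -/
theorem exists_differentiableAt_deriv_sub_ge {ι : Type*} [Finite ι] {f : ι → ℝ → ℝ} {K : NNReal}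
    (hf : ∀ i, LipschitzWith K (f i)) (i₁ i₂ : ι) {ε : ℝ} (hε : 0 < ε)
    (h : ε ≤ (f i₁ 1 - f i₂ 1) - (f i₁ 0 - f i₂ 0)) :
    ∃ s ∈ Set.Ioo (0 : ℝ) 1, (∀ i, DifferentiableAt ℝ (f i) s) ∧
      ε / 2 ≤ deriv (f i₁) s - deriv (f i₂) s := by
  by_contra! hcon
  have hd : ∀ᵐ s, ∀ i, DifferentiableAt ℝ (f i) s :=
    ae_all_iff.2 fun i => (hf i).ae_differentiableAt_real
  have hac : ∀ i, AbsolutelyContinuousOnInterval (f i) 0 1 :=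
    fun i => (hf i).lipschitzOnWith.absolutelyContinuousOnInterval
  have hint : ∫ s in (0 : ℝ)..1, (deriv (f i₁) s - deriv (f i₂) s)
      = (f i₁ 1 - f i₁ 0) - (f i₂ 1 - f i₂ 0) := by
    rw [intervalIntegral.integral_sub (hac i₁).intervalIntegrable_deriv
      (hac i₂).intervalIntegrable_deriv, (hac i₁).integral_deriv_eq_sub,
      (hac i₂).integral_deriv_eq_sub]
  have hle : ∫ s in (0 : ℝ)..1, (deriv (f i₁) s - deriv (f i₂) s)
      ≤ ∫ _s in (0 : ℝ)..1, ε / 2 := by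
    refine intervalIntegral.integral_mono_ae_restrict zero_le_one
      ((hac i₁).intervalIntegrable_deriv.sub (hac i₂).intervalIntegrable_deriv) (by simp) ?_
    rw [← restrict_Ioo_eq_restrict_Icc]
    filter_upwards [ae_restrict_of_ae hd, ae_restrict_mem measurableSet_Ioo] with s h1 h2
    exact (hcon s h2 h1).le
  simp only [intervalIntegral.integral_const, sub_zero, one_smul] at hle
  linarith

/-- **Quantitative differentiability.** For finitely many sequences with bounded increments, of
which `A i₁ - A i₂` grows by at least `ε * T` up to a large time `T`, there is an affine window on
which `A i₁ - A i₂` grows with a slope at least `ε / 2`; the size of the window is bounded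
below by a fraction of `T` that does not depend on the sequences. If there were counterexamples for
every fraction, their rescaled limits would be differentiable functions at some time, around which
windows do exist. -/
theorem exists_isAffineWindow {ι : Type*} [Finite ι] {C ε κ : ℝ} (hC : 0 ≤ C) (hε : 0 < ε)
    (hκ : 0 < κ) (hκ1 : κ ≤ 1) (i₁ i₂ : ι) :
    ∃ r > 0, ∃ T₀ : ℕ, ∀ T ≥ T₀, ∀ A : ι → ℕ → ℝ, (∀ i, A i 0 = 0) →
      (∀ i l, |A i (l + 1) - A i l| ≤ C) → ε * T ≤ A i₁ T - A i₂ T →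
      ∃ (p : ι → ℝ) (a₀ a b b₁ : ℕ), IsAffineWindow A p κ r T a₀ a b b₁ ∧
        ε / 2 ≤ p i₁ - p i₂ := by
  by_contra! hcon
  choose T hTn A hA₀ hA hgrow hno using
    fun n : ℕ => hcon (1 / ((n : ℝ) + 1)) (by positivity) (n + 1)
  obtain ⟨U, hU⟩ : ∃ U : Ultrafilter ℕ, (U : Filter ℕ) ≤ atTop := ⟨_, Ultrafilter.of_le atTop⟩
  have hTtop : Tendsto T U atTop :=
    (tendsto_atTop_mono (fun n => (Nat.le_succ n).trans (hTn n)) tendsto_id).mono_left hU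
  have hTpos : ∀ n, (0 : ℝ) < T n := fun n => by exact_mod_cast (Nat.succ_pos n).trans_le (hTn n)
  choose f hfL hf₀ hf using fun i => exists_rescaled_limit U hTtop hC (fun n => hA₀ n i)
    (fun n => hA n i)
  have hgrow' : ε ≤ (f i₁ 1 - f i₂ 1) - (f i₁ 0 - f i₂ 0) := by
    rw [hf₀, hf₀, sub_zero, sub_zero]
    refine ge_of_tendsto ((hf i₁ 1).sub (hf i₂ 1)) (Eventually.of_forall fun n => ?_)
    rw [one_mul, Nat.floor_natCast, ← sub_div, le_div_iff₀ (hTpos n)]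
    exact hgrow n
  obtain ⟨s, hs, hdiff, hslope⟩ := exists_differentiableAt_deriv_sub_ge hfL i₁ i₂ hε hgrow'
  set p : ι → ℝ := fun i => deriv (f i) s with hp
  have hpC : ∀ i, |p i| ≤ C := fun i => by
    simpa [hC] using norm_deriv_le_of_lipschitz (hfL i) (x₀ := s)
  -- the limit functions are affine up to `κ / 2` around `s`
  have hev : ∀ᶠ t in 𝓝 s, ∀ i, |f i t - f i s - (t - s) * p i| ≤ κ / 2 * |t - s| := by
    rw [eventually_all]
    intro i
    have h1 := (hasDerivAt_iff_isLittleO.1 (hdiff i).hasDerivAt).bound (half_pos hκ)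
    simpa only [Real.norm_eq_abs, smul_eq_mul] using h1
  obtain ⟨d, hd, hball⟩ := Metric.eventually_nhds_iff.1 (hev.and (isOpen_Ioo.mem_nhds hs))
  -- the window is `s - w, s, s + h, s + w`; the tolerance `τ` for passing from the limits to the
  -- sequences is small enough for all its conditions
  set w := d / 2 with hw
  set h := κ * w / 2 with hh
  have hwpos : 0 < w := half_pos hd
  have hhpos : 0 < h := by positivity
  have hhw : h ≤ w := by nlinarith
  set τ := κ * h / (4 * (1 + C + κ)) with hτ
  have hden : 0 < 4 * (1 + C + κ) := by positivity
  have hτpos : 0 < τ := by positivity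
  have hτeq : 4 * (1 + C + κ) * τ = κ * h := by rw [hτ]; field_simp
  have hτh : τ ≤ h / 4 := by nlinarith [mul_nonneg hC hτpos.le]
  have hτw : 2 * τ + 2 * κ * τ ≤ h := by nlinarith [mul_nonneg hC hτpos.le]
  have hin : ∀ t, |t - s| ≤ w → (∀ i, |f i t - f i s - (t - s) * p i| ≤ κ / 2 * |t - s|) ∧
      t ∈ Set.Ioo (0 : ℝ) 1 := fun t ht => hball (by rw [Real.dist_eq]; linarith)
  -- the sequences follow their limits at the four times of the window
  have hclose : ∀ t : ℝ, ∀ᶠ n in (U : Filter ℕ), ∀ i,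
      |A n i ⌊t * T n⌋₊ - f i t * T n| ≤ τ * T n := by
    intro t
    rw [eventually_all]
    intro i
    filter_upwards [Metric.tendsto_nhds.1 (hf i t) τ hτpos] with n hn
    rw [Real.dist_eq] at hn
    have h2 : A n i ⌊t * T n⌋₊ - f i t * T n = (A n i ⌊t * T n⌋₊ / T n - f i t) * T n := by
      have := hTpos n
      field_simp
    rw [h2, abs_mul, Nat.abs_cast]
    have := hTpos n
    gcongr
  have hbig : ∀ᶠ n in (U : Filter ℕ), 1 ≤ τ * T n :=
    ((tendsto_natCast_atTop_atTop.comp hTtop).const_mul_atTop hτpos).eventually_ge_atTop 1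
  have hr : ∀ᶠ n : ℕ in (U : Filter ℕ), 1 / ((n : ℝ) + 1) ≤ h / 2 :=
    hU ((tendsto_one_div_add_atTop_nhds_zero_nat (𝕜 := ℝ)).eventually_le_const (half_pos hhpos))
  obtain ⟨n, hn₀, hn₁, hn₂, hn₃, hnbig, hnr⟩ := (((hclose s).and ((hclose (s - w)).and
    ((hclose (s + h)).and ((hclose (s + w)).and (hbig.and hr)))))).exists
  have hfloor : ∀ t : ℝ, 0 < t → t * T n - τ * T n ≤ (⌊t * T n⌋₊ : ℕ) ∧
      ((⌊t * T n⌋₊ : ℕ) : ℝ) ≤ t * T n := fun t ht => by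
    have h1 := Nat.lt_floor_add_one (t * T n)
    have h2 := Nat.floor_le (mul_pos ht (hTpos n)).le
    constructor <;> linarith
  have haff : ∀ t, |t - s| ≤ w → h ≤ |t - s| →
      (∀ i, |A n i ⌊t * T n⌋₊ - f i t * T n| ≤ τ * T n) → ∀ i,
      |A n i ⌊t * T n⌋₊ - A n i ⌊s * T n⌋₊ -
          (((⌊t * T n⌋₊ : ℕ) : ℝ) - (⌊s * T n⌋₊ : ℕ)) * p i| ≤
        κ * |((⌊t * T n⌋₊ : ℕ) : ℝ) - (⌊s * T n⌋₊ : ℕ)| := by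
    intro t htw hth hcl i
    obtain ⟨h1, h2⟩ := hin t htw
    obtain ⟨h3, h4⟩ := hfloor t h2.1
    obtain ⟨h5, h6⟩ := hfloor s hs.1
    set X : ℝ := ((⌊t * T n⌋₊ : ℕ) : ℝ)
    set Y : ℝ := ((⌊s * T n⌋₊ : ℕ) : ℝ)
    have hT := hTpos n
    have hXY : |(X - Y) - (t - s) * T n| ≤ τ * T n := by
      rw [abs_le]; constructor <;> linarith
    have e1 : A n i ⌊t * T n⌋₊ - A n i ⌊s * T n⌋₊ - (X - Y) * p i =
        (A n i ⌊t * T n⌋₊ - f i t * T n) - (A n i ⌊s * T n⌋₊ - f i s * T n) +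
        (f i t - f i s - (t - s) * p i) * T n - ((X - Y) - (t - s) * T n) * p i := by ring
    have e2 : |(f i t - f i s - (t - s) * p i) * T n| ≤ κ / 2 * |t - s| * T n := by
      rw [abs_mul, Nat.abs_cast]
      exact mul_le_mul_of_nonneg_right (h1 i) hT.le
    have e3 : |((X - Y) - (t - s) * T n) * p i| ≤ τ * T n * C := by
      rw [abs_mul]
      exact mul_le_mul hXY (hpC i) (abs_nonneg _) (by positivity)
    have e4 : |t - s| * T n - τ * T n ≤ |X - Y| := by
      have := abs_sub_abs_le_abs_sub ((t - s) * T n) (X - Y)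
      rw [abs_sub_comm (_ * _), abs_mul, Nat.abs_cast] at this
      linarith
    have e5 : 2 * τ + τ * C + κ * τ ≤ κ / 2 * |t - s| := by
      nlinarith [mul_nonneg hC hτpos.le]
    have e6 := mul_le_mul_of_nonneg_right e5 hT.le
    have e7 := mul_le_mul_of_nonneg_left e4 hκ.le
    rw [e1]
    calc _ ≤ |A n i ⌊t * T n⌋₊ - f i t * T n| + |A n i ⌊s * T n⌋₊ - f i s * T n| +
        |(f i t - f i s - (t - s) * p i) * T n| + |((X - Y) - (t - s) * T n) * p i| :=
          (abs_sub _ _).trans (add_le_add_left ((abs_add_le _ _).trans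
            (add_le_add_left (abs_sub _ _) _)) _)
      _ ≤ τ * T n + τ * T n + κ / 2 * |t - s| * T n + τ * T n * C := by
          gcongr
          · exact hcl i
          · exact hn₀ i
      _ ≤ _ := by linarith
  have hT := hTpos n
  have m1 : |s - w - s| = w := by rw [sub_sub_cancel_left, abs_neg, abs_of_pos hwpos]
  have m2 : |s + h - s| = h := by rw [add_sub_cancel_left, abs_of_pos hhpos]
  have m3 : |s + w - s| = w := by rw [add_sub_cancel_left, abs_of_pos hwpos]
  obtain ⟨-, q1⟩ := hin (s - w) m1.le
  obtain ⟨-, q2⟩ := hin (s + h) (m2.le.trans hhw)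
  obtain ⟨-, q3⟩ := hin (s + w) m3.le
  obtain ⟨f1, f1'⟩ := hfloor (s - w) q1.1
  obtain ⟨f2, f2'⟩ := hfloor (s + h) q2.1
  obtain ⟨f3, f3'⟩ := hfloor (s + w) q3.1
  obtain ⟨f4, f4'⟩ := hfloor s hs.1
  have g1 := haff (s - w) m1.le (hhw.trans m1.ge) hn₁
  have g2 := haff (s + h) (m2.le.trans hhw) m2.ge hn₂
  have g3 := haff (s + w) m3.le (hhw.trans m3.ge) hn₃
  have hτhT := mul_le_mul_of_nonneg_right hτh hT.le
  have hhwT := mul_le_mul_of_nonneg_right hhw hT.le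
  have hτwT := mul_le_mul_of_nonneg_right hτw hT.le
  have hκw : κ * (w * T n) = 2 * (h * T n) := by rw [hh]; ring
  have hhT : 0 < h * T n := by positivity
  refine absurd hslope (not_le.2 (hno n p ⌊(s - w) * T n⌋₊ ⌊s * T n⌋₊ ⌊(s + h) * T n⌋₊
    ⌊(s + w) * T n⌋₊ ⟨?_, ?_, ?_, ?_, ?_, ?_, ?_⟩))
  · exact_mod_cast f2'.trans (mul_le_of_le_one_left hT.le q2.2.le)
  · have := mul_le_mul_of_nonneg_right hnr hT.le
    linarith
  · have : κ * (w * T n - τ * T n) ≤ κ * ((⌊s * T n⌋₊ : ℕ) - (⌊(s - w) * T n⌋₊ : ℕ)) :=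
      mul_le_mul_of_nonneg_left (by linarith) hκ.le
    linarith
  · have : κ * (w * T n - τ * T n) ≤ κ * ((⌊(s + w) * T n⌋₊ : ℕ) - (⌊s * T n⌋₊ : ℕ)) :=
      mul_le_mul_of_nonneg_left (by linarith) hκ.le
    linarith
  · intro i
    have := g1 i
    rw [abs_of_nonpos (a := ((⌊(s - w) * T n⌋₊ : ℕ) : ℝ) - _) (by linarith), neg_sub] at this
    rwa [← neg_sub ((⌊(s - w) * T n⌋₊ : ℕ) : ℝ), neg_mul, ← sub_eq_add_neg, neg_sub]
  · intro i
    have := g2 i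
    rwa [abs_of_nonneg (a := ((⌊(s + h) * T n⌋₊ : ℕ) : ℝ) - _) (by linarith)] at this
  · intro i
    have := g3 i
    rwa [abs_of_nonneg (a := ((⌊(s + w) * T n⌋₊ : ℕ) : ℝ) - _) (by linarith)] at this

/-! ### Best responses on an affine window -/

section Response

variable {Z : Type*}

/-- Total payoff of the constant strategy `z` against the first `t` strategies of the opponent. -/
def cumulativePayoff (v : Z → Z → ℝ) (y : ℕ → Z) (t : ℕ) (z : Z) : ℝ :=
  ∑ k ∈ Finset.range t, v z (y k)

/-- Largest total payoff of a constant strategy against the first `t` strategies of the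
opponent, as a supremum over `Z`; it is meaningful for bounded payoffs. -/
noncomputable def bestCumulativePayoff (v : Z → Z → ℝ) (y : ℕ → Z) (t : ℕ) : ℝ :=
  ⨆ z, cumulativePayoff v y t z

/-- The strategies `x` of a player with payoff `v` are best responses, up to the errors `e`, to the
averages of the past strategies `y` of the opponent. The averages are multiplied by `t`, so that the
condition is void at `t = 0`. -/
structure IsApproxResponse (v : Z → Z → ℝ) (x y : ℕ → Z) (e : ℕ → ℝ) : Prop where
  err_nonneg : ∀ t, 0 ≤ e t
  response : ∀ t z, cumulativePayoff v y t z - t * e t ≤ cumulativePayoff v y t (x t)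

variable {v : Z → Z → ℝ} {x y : ℕ → Z} {e : ℕ → ℝ} {C : ℝ}

theorem cumulativePayoff_succ (t : ℕ) (z : Z) :
    cumulativePayoff v y (t + 1) z = cumulativePayoff v y t z + v z (y t) :=
  Finset.sum_range_succ _ _

theorem cumulativePayoff_sub {s t : ℕ} (h : s ≤ t) (z : Z) :
    cumulativePayoff v y t z - cumulativePayoff v y s z = ∑ k ∈ Finset.Ico s t, v z (y k) :=
  (Finset.sum_Ico_eq_sub _ h).symm

theorem abs_cumulativePayoff_succ_sub_le (hv : ∀ z w, |v z w| ≤ C) (t : ℕ) (z : Z) :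
    |cumulativePayoff v y (t + 1) z - cumulativePayoff v y t z| ≤ C := by
  rw [cumulativePayoff_succ, add_sub_cancel_left]
  exact hv _ _

theorem bddAbove_cumulativePayoff (hv : ∀ z w, |v z w| ≤ C) (t : ℕ) :
    BddAbove (Set.range (cumulativePayoff v y t)) := by
  refine ⟨t * C, ?_⟩
  rintro _ ⟨z, rfl⟩
  simpa [cumulativePayoff] using
    Finset.sum_le_card_nsmul (Finset.range t) (fun k => v z (y k)) C
      fun k _ => (le_abs_self _).trans (hv _ _)

theorem cumulativePayoff_le_best (hv : ∀ z w, |v z w| ≤ C) (t : ℕ) (z : Z) :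
    cumulativePayoff v y t z ≤ bestCumulativePayoff v y t :=
  le_ciSup (bddAbove_cumulativePayoff hv t) z

theorem IsApproxResponse.best_le [Nonempty Z] (h : IsApproxResponse v x y e) (t : ℕ) :
    bestCumulativePayoff v y t ≤ cumulativePayoff v y t (x t) + t * e t :=
  ciSup_le fun z => by linarith [h.response t z]

theorem bestCumulativePayoff_zero [Nonempty Z] : bestCumulativePayoff v y 0 = 0 := by
  simp [bestCumulativePayoff, cumulativePayoff]

theorem abs_bestCumulativePayoff_succ_sub_le [Nonempty Z] (hv : ∀ z w, |v z w| ≤ C) (t : ℕ) :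
    |bestCumulativePayoff v y (t + 1) - bestCumulativePayoff v y t| ≤ C := by
  have h (z) := abs_le.1 (abs_cumulativePayoff_succ_sub_le (y := y) hv t z)
  rw [abs_sub_le_iff, sub_le_iff_le_add, sub_le_iff_le_add]
  constructor <;> refine ciSup_le fun z => ?_
  · linarith [cumulativePayoff_le_best (y := y) hv t z, h z]
  · linarith [cumulativePayoff_le_best (y := y) hv (t + 1) z, h z]

theorem abs_cumulativePayoff_sub_sub_le {z z' : Z} {κ : ℝ}
    (h : ∀ w, |v z w - v z' w| ≤ κ) {s t : ℕ} (hst : s ≤ t) :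
    |(cumulativePayoff v y t z - cumulativePayoff v y s z) -
      (cumulativePayoff v y t z' - cumulativePayoff v y s z')| ≤ κ * ((t : ℝ) - s) := by
  rw [cumulativePayoff_sub hst, cumulativePayoff_sub hst, ← Finset.sum_sub_distrib]
  calc _ ≤ ∑ k ∈ Finset.Ico s t, |v z (y k) - v z' (y k)| := Finset.abs_sum_le_sum_abs _ _
    _ ≤ ∑ _k ∈ Finset.Ico s t, κ := Finset.sum_le_sum fun k _ => h _
    _ = _ := by
      rw [Finset.sum_const, Nat.card_Ico, nsmul_eq_mul, Nat.cast_sub hst, mul_comm]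

variable {ι : Type*} {A : ι → ℕ → ℝ} {p : ι → ℝ} {κ r : ℝ} {T a₀ a b b₁ : ℕ}

/-- Envelope estimate: on an affine window, a strategy chosen in the block earns almost the slope of
the best cumulative payoff. It is nearly optimal at the time of its choice and not
better than optimal at the much more distant times `a₀` and `b₁`, which bounds its slope from below
and from above. -/
theorem IsApproxResponse.abs_cumulativePayoff_sub_slope_le [Nonempty Z]
    (h : IsApproxResponse v x y e)
    (hv : ∀ z w, |v z w| ≤ C) (hw : IsAffineWindow A p κ r T a₀ a b b₁)
    (hκ : 0 < κ) (hκ1 : κ ≤ 1) (hr : 0 < r) (hT : 0 < T) {i₀ : ι} (hi₀ : A i₀ = bestCumulativePayoff v y)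
    (hnet : ∀ z, ∃ i, ∀ s t, s ≤ t → |(cumulativePayoff v y t z - cumulativePayoff v y s z) -
      (A i t - A i s)| ≤ κ * ((t : ℝ) - s)) {l : ℕ} (hl : l ∈ Finset.Ico a b) :
    |cumulativePayoff v y b (x l) - cumulativePayoff v y a (x l) - ((b : ℝ) - a) * p i₀| ≤
      ((b : ℝ) - a) * ((5 + 2 * C) * κ + e l / r) := by
  obtain ⟨hal, hlb⟩ := Finset.mem_Ico.1 hl
  have hal' : (a : ℝ) ≤ l := by exact_mod_cast hal
  have hlb' : (l : ℝ) ≤ b := by exact_mod_cast hlb.le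
  have hbT : (b : ℝ) ≤ T := by exact_mod_cast hw.le_horizon
  have hT' : (0 : ℝ) < T := by exact_mod_cast hT
  have hL : 0 < (b : ℝ) - a := (mul_pos hr hT').trans_le hw.length_ge
  have hC : 0 ≤ C := (abs_nonneg _).trans (hv (x 0) (x 0))
  have he := h.err_nonneg l
  -- the outer intervals have positive lengths, at least that of the block, hence at least `r * T`
  have hout : ∀ R, (b : ℝ) - a ≤ κ * R → 0 < R ∧ (l : ℝ) * e l ≤ R * (e l / r) := by
    intro R hR
    have hR₀ : 0 < R := by
      by_contra! hneg
      nlinarith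
    refine ⟨hR₀, ?_⟩
    have h1 : r * l ≤ R := by
      have := hw.length_ge
      nlinarith
    rw [mul_div_assoc', le_div_iff₀ hr]
    nlinarith
  obtain ⟨hR₁, hη₁⟩ := hout _ hw.length_le_right
  obtain ⟨hR₀, hη₀⟩ := hout _ hw.length_le_left
  have ha₀ : a₀ ≤ a := by exact_mod_cast (sub_pos.1 hR₀).le
  have hb₁ : a ≤ b₁ := by exact_mod_cast (sub_pos.1 hR₁).le
  have hab : a ≤ b := hal.trans hlb.le
  obtain ⟨i, hi⟩ := hnet (x l)
  have n₀ := abs_le.1 (hi a₀ a ha₀)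
  have n₁ := abs_le.1 (hi a b₁ hb₁)
  have nb := abs_le.1 (hi a b hab)
  have w₀ := abs_le.1 (hw.left i)
  have w₁ := abs_le.1 (hw.right i)
  have wb := abs_le.1 (hw.block i)
  have m₀ := abs_le.1 (hw.left i₀)
  have m₁ := abs_le.1 (hw.right i₀)
  rw [hi₀] at m₀ m₁
  -- the strategy is nearly optimal at time `a`
  have hopt : bestCumulativePayoff v y a - 2 * C * ((b : ℝ) - a) - l * e l ≤
      cumulativePayoff v y a (x l) := by
    have c1 := abs_le.1 (abs_sub_le_of_abs_succ_sub_le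
      (A := fun t => cumulativePayoff v y t (x l))
      (fun t => abs_cumulativePayoff_succ_sub_le (y := y) hv t (x l)) hal)
    have c2 := abs_le.1 (abs_sub_le_of_abs_succ_sub_le
      (fun t => abs_bestCumulativePayoff_succ_sub_le (y := y) hv t) hal)
    have c3 := h.best_le l
    have c4 : C * ((l : ℝ) - a) ≤ C * ((b : ℝ) - a) := by gcongr
    linarith
  have o₀ := cumulativePayoff_le_best (y := y) hv a₀ (x l)
  have o₁ := cumulativePayoff_le_best (y := y) hv b₁ (x l)
  have l₀ := mul_le_mul_of_nonneg_left hw.length_le_left hC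
  have l₁ := mul_le_mul_of_nonneg_left hw.length_le_right hC
  have up : p i - p i₀ ≤ (3 + 2 * C) * κ + e l / r := by
    refine le_of_mul_le_mul_left ?_ hR₁
    linarith
  have lo : p i₀ - p i ≤ (3 + 2 * C) * κ + e l / r := by
    refine le_of_mul_le_mul_left ?_ hR₀
    linarith
  have up' := mul_le_mul_of_nonneg_left up hL.le
  have lo' := mul_le_mul_of_nonneg_left lo hL.le
  rw [abs_le]
  constructor <;> linarith

/-- On an affine window, the payoff accumulated between the two blocks of strategies is almost
the slope of the best cumulative payoff, times the square of the block length. -/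
theorem IsApproxResponse.abs_sum_block_sub_le [Nonempty Z]
    (h : IsApproxResponse v x y e)
    (hv : ∀ z w, |v z w| ≤ C) (hw : IsAffineWindow A p κ r T a₀ a b b₁)
    (hκ : 0 < κ) (hκ1 : κ ≤ 1) (hr : 0 < r) (hT : 0 < T) {i₀ : ι} (hi₀ : A i₀ = bestCumulativePayoff v y)
    (hnet : ∀ z, ∃ i, ∀ s t, s ≤ t → |(cumulativePayoff v y t z - cumulativePayoff v y s z) -
      (A i t - A i s)| ≤ κ * ((t : ℝ) - s)) :
    |∑ l ∈ Finset.Ico a b, ∑ k ∈ Finset.Ico a b, v (x l) (y k) - ((b : ℝ) - a) ^ 2 * p i₀| ≤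
      ((b : ℝ) - a) * ((5 + 2 * C) * κ * ((b : ℝ) - a) + (∑ l ∈ Finset.range T, e l) / r) := by
  have hL : 0 < (b : ℝ) - a :=
    (mul_pos hr (by exact_mod_cast hT)).trans_le hw.length_ge
  have hab : a ≤ b := by exact_mod_cast (sub_pos.1 hL).le
  have hcard : ((Finset.Ico a b).card : ℝ) = (b : ℝ) - a := by
    rw [Nat.card_Ico, Nat.cast_sub hab]
  have e1 : ∑ l ∈ Finset.Ico a b, ∑ k ∈ Finset.Ico a b, v (x l) (y k) - ((b : ℝ) - a) ^ 2 * p i₀ =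
      ∑ l ∈ Finset.Ico a b, (cumulativePayoff v y b (x l) - cumulativePayoff v y a (x l) -
        ((b : ℝ) - a) * p i₀) := by
    rw [Finset.sum_sub_distrib, Finset.sum_const, nsmul_eq_mul, hcard]
    simp_rw [cumulativePayoff_sub hab]
    ring
  have e2 : ∑ l ∈ Finset.Ico a b, e l ≤ ∑ l ∈ Finset.range T, e l := by
    refine Finset.sum_le_sum_of_subset_of_nonneg (fun l hl => ?_) fun l _ _ => h.err_nonneg l
    exact Finset.mem_range.2 ((Finset.mem_Ico.1 hl).2.trans_le hw.le_horizon)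
  rw [e1]
  calc _ ≤ ∑ l ∈ Finset.Ico a b, ((b : ℝ) - a) * ((5 + 2 * C) * κ + e l / r) :=
        (Finset.abs_sum_le_sum_abs _ _).trans (Finset.sum_le_sum fun l hl =>
          h.abs_cumulativePayoff_sub_slope_le hv hw hκ hκ1 hr hT hi₀ hnet hl)
    _ = ((b : ℝ) - a) * ((5 + 2 * C) * κ * ((b : ℝ) - a) + (∑ l ∈ Finset.Ico a b, e l) / r) := by
        rw [← Finset.mul_sum, Finset.sum_add_distrib, Finset.sum_const, nsmul_eq_mul, hcard,
          Finset.sum_div]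
        ring
    _ ≤ _ := by gcongr

end Response

/-! ### Fictitious play with a continuous payoff -/

section Gap

variable {Z : Type*} [MetricSpace Z] [CompactSpace Z] {u : Z → Z → ℝ}

theorem exists_abs_le_of_continuous (hu : Continuous fun p : Z × Z => u p.1 p.2) :
    ∃ C, ∀ z w, |u z w| ≤ C := by
  obtain ⟨C, hC⟩ := isCompact_univ.exists_bound_of_continuousOn hu.continuousOn
  exact ⟨C, fun z w => hC (z, w) trivial⟩

/-- A continuous payoff is determined up to `κ` by finitely many strategies of either player. -/
theorem exists_finite_net (hu : Continuous fun p : Z × Z => u p.1 p.2) {κ : ℝ} (hκ : 0 < κ) :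
    ∃ S : Set Z, S.Finite ∧ ∀ z, ∃ z' ∈ S, ∀ w, |u z w - u z' w| ≤ κ ∧ |u w z - u w z'| ≤ κ := by
  obtain ⟨d, hd, h⟩ := Metric.uniformContinuous_iff.1
    (CompactSpace.uniformContinuous_of_continuous hu) κ hκ
  obtain ⟨S, hS, hcov⟩ := Metric.totallyBounded_iff.1 (isCompact_univ (X := Z)).totallyBounded d hd
  refine ⟨S, hS, fun z => ?_⟩
  obtain ⟨z', hz', hz⟩ := Set.mem_iUnion₂.1 (hcov (Set.mem_univ z))
  have hz := Metric.mem_ball.1 hz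
  refine ⟨z', hz', fun w => ⟨?_, ?_⟩⟩
  · exact (h (a := (z, w)) (b := (z', w)) (by rw [Prod.dist_eq, dist_self]; exact max_lt hz hd)).le
  · exact (h (a := (w, z)) (b := (w, z')) (by rw [Prod.dist_eq, dist_self]; exact max_lt hd hz)).le

/-- **Convergence of approximate fictitious play.** If the average errors up to a large time `T`
are small, then the empirical strategies up to time `T` have a small duality gap, uniformly over
all plays. On an affine window on which the gap grows, the payoff between the two blocks of
strategies would be close both to the slope of player 1's best payoff and to the smaller slope of
player 2's best payoff. -/
theorem exists_gap_le [Nonempty Z] (hu : Continuous fun p : Z × Z => u p.1 p.2) {ε : ℝ} (hε : 0 < ε) :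
    ∃ δ > 0, ∃ T₀ : ℕ, ∀ (x y : ℕ → Z) (e₁ e₂ : ℕ → ℝ), IsApproxResponse u x y e₁ →
      IsApproxResponse (fun w z => -u z w) y x e₂ → ∀ T ≥ T₀,
      ∑ t ∈ Finset.range T, (e₁ t + e₂ t) ≤ δ * T → ∀ z w,
      cumulativePayoff u y T z + cumulativePayoff (fun w z => -u z w) x T w ≤ ε * T := by
  obtain ⟨C, hC⟩ := exists_abs_le_of_continuous hu
  have hC' : ∀ w z, |(fun w z => -u z w) w z| ≤ C := fun w z => by simpa using hC z w
  have hC₀ : 0 ≤ C :=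
    (abs_nonneg _).trans (hC (Classical.arbitrary Z) (Classical.arbitrary Z))
  -- the errors of the block estimates add up to `2 * (5 + 2 * C) * κ + κ < ε / 2`
  obtain ⟨κ, hκ, hκ1, hκε⟩ : ∃ κ > 0, κ ≤ 1 ∧ (11 + 4 * C) * κ < ε / 2 := by
    refine ⟨min 1 (ε / 4 / (11 + 4 * C)), by positivity, min_le_left _ _, ?_⟩
    calc (11 + 4 * C) * min 1 (ε / 4 / (11 + 4 * C))
        ≤ (11 + 4 * C) * (ε / 4 / (11 + 4 * C)) := by gcongr; exact min_le_right _ _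
      _ = ε / 4 := by field_simp
      _ < ε / 2 := by linarith
  obtain ⟨S, hS, hnet⟩ := exists_finite_net hu hκ
  have : Finite S := hS
  obtain ⟨r, hr, T₀, hT₀⟩ := exists_isAffineWindow (ι := (S ⊕ S) ⊕ Bool) hC₀ hε hκ hκ1
    (Sum.inr true) (Sum.inr false)
  refine ⟨κ * r ^ 2, by positivity, max T₀ 1, fun x y e₁ e₂ h₁ h₂ T hT herr z w => ?_⟩
  by_contra! hgap
  have hT1 : 0 < T := (le_max_right _ _).trans hT
  set v : Z → Z → ℝ := fun w z => -u z w with hv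
  -- the second slope is that of `min_w ∑ u (x k) w`, which is minus the best payoff of player 2
  obtain ⟨p, a₀, a, b, b₁, hwin, hp⟩ := hT₀ T ((le_max_left _ _).trans hT)
    (Sum.elim (Sum.elim (fun s t => cumulativePayoff u y t s) fun s t => -cumulativePayoff v x t s)
      fun i => if i then bestCumulativePayoff u y else -bestCumulativePayoff v x)
    (by
      rintro ((s | s) | (_ | _)) <;>
        simp [bestCumulativePayoff_zero, cumulativePayoff])
    (by
      rintro ((s | s) | (_ | _)) l
      · exact abs_cumulativePayoff_succ_sub_le hC l _
      · simpa [abs_sub_comm, add_comm, ← sub_eq_add_neg] using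
          abs_cumulativePayoff_succ_sub_le (y := x) hC' l s.1
      · simpa [abs_sub_comm, add_comm, ← sub_eq_add_neg] using
          abs_bestCumulativePayoff_succ_sub_le (y := x) hC' l
      · simpa using abs_bestCumulativePayoff_succ_sub_le (y := y) hC l)
    (by
      simp only [Sum.elim_inr, if_true, Bool.false_eq_true, if_false, Pi.neg_apply]
      linarith [cumulativePayoff_le_best (y := y) hC T z,
        cumulativePayoff_le_best (y := x) hC' T w])
  have hwin' : IsAffineWindow
      (fun i => -(Sum.elim (Sum.elim (fun (s : S) t => cumulativePayoff u y t s)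
        fun (s : S) t => -cumulativePayoff v x t s)
        fun i : Bool => if i then bestCumulativePayoff u y else -bestCumulativePayoff v x) i)
      (fun i => -p i) κ r T a₀ a b b₁ := by
    refine ⟨hwin.le_horizon, hwin.length_ge, hwin.length_le_left, hwin.length_le_right,
      fun i => ?_, fun i => ?_, fun i => ?_⟩
    · rw [← abs_neg]; convert hwin.left i using 2; simp only [Pi.neg_apply]; ring
    · rw [← abs_neg]; convert hwin.block i using 2; simp only [Pi.neg_apply]; ring
    · rw [← abs_neg]; convert hwin.right i using 2; simp only [Pi.neg_apply]; ring
  have b₁ := h₁.abs_sum_block_sub_le hC hwin hκ hκ1 hr hT1 (i₀ := Sum.inr true) (by simp) fun z => by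
    obtain ⟨z', hz', h⟩ := hnet z
    exact ⟨Sum.inl (Sum.inl ⟨z', hz'⟩), fun s t hst =>
      abs_cumulativePayoff_sub_sub_le (fun w => (h w).1) hst⟩
  have b₂ := h₂.abs_sum_block_sub_le hC' hwin' hκ hκ1 hr hT1 (i₀ := Sum.inr false) (by simp)
    fun z => by
    obtain ⟨z', hz', h⟩ := hnet z
    refine ⟨Sum.inl (Sum.inr ⟨z', hz'⟩), fun s t hst => ?_⟩
    simpa using abs_cumulativePayoff_sub_sub_le (v := v) (y := x) (z := z) (z' := z')
      (fun w => by simpa [hv, abs_sub_comm, add_comm, ← sub_eq_add_neg] using (h w).2) hst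
  have hsum : ∑ l ∈ Finset.Ico a b, ∑ k ∈ Finset.Ico a b, v (y l) (x k) =
      -∑ l ∈ Finset.Ico a b, ∑ k ∈ Finset.Ico a b, u (x l) (y k) := by
    rw [Finset.sum_comm]
    simp [hv]
  rw [hsum] at b₂
  have hTr : (0 : ℝ) < T := by exact_mod_cast hT1
  have hLT := hwin.length_ge
  set L : ℝ := (b : ℝ) - a
  have hL : 0 < L := (mul_pos hr hTr).trans_le hLT
  have hE : (∑ l ∈ Finset.range T, e₁ l) / r + (∑ l ∈ Finset.range T, e₂ l) / r ≤ κ * L := by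
    rw [← add_div, ← Finset.sum_add_distrib, div_le_iff₀ hr]
    calc _ ≤ κ * r ^ 2 * T := herr
      _ = κ * (r * T) * r := by ring
      _ ≤ κ * L * r := by gcongr
  have c₁ := (abs_le.1 b₁).1
  have c₂ := (abs_le.1 b₂).1
  have hE' := mul_le_mul_of_nonneg_left hE hL.le
  have hp' := mul_le_mul_of_nonneg_left hp (sq_nonneg L)
  have hκ' := mul_lt_mul_of_pos_left hκε (pow_pos hL 2)
  nlinarith

/-- Exact fictitious play exists. It is driven by the pair of cumulative payoffs, whose maximizers
are the next strategies. -/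
theorem exists_exact_response [Nonempty Z] (hu : Continuous fun p : Z × Z => u p.1 p.2) :
    ∃ x y : ℕ → Z, IsApproxResponse u x y 0 ∧ IsApproxResponse (fun w z => -u z w) y x 0 := by
  have hmax : ∀ f : Z → ℝ, ∃ z, Continuous f → ∀ z', f z' ≤ f z := fun f => by
    by_cases hf : Continuous f
    · obtain ⟨z, -, hz⟩ := isCompact_univ.exists_isMaxOn Set.univ_nonempty hf.continuousOn
      exact ⟨z, fun _ z' => hz (Set.mem_univ z')⟩
    · exact ⟨Classical.arbitrary Z, fun h => absurd h hf⟩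
  choose br hbr using hmax
  let st : ℕ → (Z → ℝ) × (Z → ℝ) := fun n => Nat.rec (0, 0)
    (fun _ s => (fun z => s.1 z + u z (br s.2), fun w => s.2 w + -u (br s.1) w)) n
  let x : ℕ → Z := fun n => br (st n).1
  let y : ℕ → Z := fun n => br (st n).2
  have hx : ∀ n, cumulativePayoff u y n = (st n).1 := fun n => by
    induction n with
    | zero => funext z; simp [cumulativePayoff, st]
    | succ n ih => funext z; rw [cumulativePayoff_succ, ih]
  have hy : ∀ n, cumulativePayoff (fun w z => -u z w) x n = (st n).2 := fun n => by
    induction n with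
    | zero => funext z; simp [cumulativePayoff, st]
    | succ n ih => funext z; rw [cumulativePayoff_succ, ih]
  have hu₁ : ∀ w, Continuous fun z => u z w := fun w =>
    hu.comp (continuous_id.prodMk continuous_const)
  have hu₂ : ∀ z, Continuous fun w => u z w := fun z =>
    hu.comp (continuous_const.prodMk continuous_id)
  refine ⟨x, y, ⟨fun _ => le_rfl, fun t z => ?_⟩, ⟨fun _ => le_rfl, fun t z => ?_⟩⟩
  · have hc : Continuous (st t).1 := by
      rw [← hx]
      exact continuous_finsetSum _ fun k _ => hu₁ _
    simpa [hx] using hbr _ hc z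
  · have hc : Continuous (st t).2 := by
      rw [← hy]
      exact continuous_finsetSum _ fun k _ => (hu₂ _).neg
    simpa [hy] using hbr _ hc z

end Gap

/-! ### Approximate equilibria, empirical distributions and error floors -/

section Measurable

variable {Z : Type*} [MeasurableSpace Z] {u : Z → Z → ℝ}

theorem LatentGame.IsApproxNash.mono {ε ε' : ℝ} {μ ν : Measure Z}
    (h : LatentGame.IsApproxNash u ε μ ν) (hε : ε ≤ ε') : LatentGame.IsApproxNash u ε' μ ν :=
  ⟨h.prob₁, h.prob₂, fun μ' hμ' => by linarith [h.dev₁ μ' hμ'],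
    fun ν' hν' => by linarith [h.dev₂ ν' hν']⟩

/-- The payoff of an exact equilibrium is the value of the game. -/
theorem LatentGame.IsApproxNash.isValue {μ ν : Measure Z} (h : LatentGame.IsApproxNash u 0 μ ν) :
    LatentGame.IsValue u (LatentGame.mixedPayoff u μ ν) :=
  ⟨⟨μ, h.prob₁, fun ν' hν' => by linarith [h.dev₂ ν' hν']⟩,
    ⟨ν, h.prob₂, fun μ' hμ' => by linarith [h.dev₁ μ' hμ']⟩⟩

theorem isProbabilityMeasure_empirical (z : ℕ → Z) {T : ℕ} (hT : 1 ≤ T) :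
    IsProbabilityMeasure (LatentGame.empirical z T) := by
  refine ⟨?_⟩
  have : (T : ENNReal) ≠ 0 := by exact_mod_cast (by omega : T ≠ 0)
  simp [LatentGame.empirical, ENNReal.inv_mul_cancel this (ENNReal.natCast_ne_top T)]

theorem integral_empirical [MeasurableSingletonClass Z] (z : ℕ → Z) (T : ℕ) (f : Z → ℝ) :
    ∫ w, f w ∂(LatentGame.empirical z T) = (∑ t ∈ Finset.range T, f (z t)) / T := by
  rw [LatentGame.empirical, integral_smul_measure,
    integral_finsetSum_measure fun t _ => integrable_dirac (by simp)]
  simp [div_eq_inv_mul]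

/-- Whether, from some time on and uniformly over all plays, an average error of at most `δ`
guarantees an `ε`-equilibrium. -/
def IsEventualAccuracy (u : Z → Z → ℝ) (δ ε : ℝ) : Prop :=
  ∃ T₀ : ℕ, ∀ (z₁ z₂ : ℕ → Z) (e₁ e₂ : ℕ → ℝ),
    LatentGame.IsApproxFictitiousPlay u z₁ z₂ e₁ e₂ →
    ∀ T : ℕ, T₀ ≤ T → LatentGame.averageError e₁ e₂ T ≤ δ →
      LatentGame.IsApproxNash u ε (LatentGame.empirical z₁ T) (LatentGame.empirical z₂ T)

theorem IsEventualAccuracy.anti {δ δ' ε : ℝ} (h : IsEventualAccuracy u δ ε) (hδ : δ' ≤ δ) :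
    IsEventualAccuracy u δ' ε := by
  obtain ⟨T₀, h⟩ := h
  exact ⟨T₀, fun z₁ z₂ e₁ e₂ hp T hT hE => h z₁ z₂ e₁ e₂ hp T hT (hE.trans hδ)⟩

/-- The best accuracy that an average error of at most `δ` guarantees in the long run: an infimum
of nonnegative numbers, over a nonempty set if the payoff is bounded. -/
noncomputable def errorFloor (u : Z → Z → ℝ) (δ : ℝ) : ℝ :=
  sInf {ε | 0 < ε ∧ IsEventualAccuracy u δ ε}

end Measurable

/-! ### Mixed payoffs and the duality gap -/

section Mixed

variable {Z : Type*} [MetricSpace Z] [CompactSpace Z] [MeasurableSpace Z] [BorelSpace Z]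
  {u : Z → Z → ℝ}

theorem integrable_payoff (hu : Continuous fun p : Z × Z => u p.1 p.2) (μ ν : Measure Z)
    [IsProbabilityMeasure μ] [IsProbabilityMeasure ν] :
    Integrable (fun p : Z × Z => u p.1 p.2) (μ.prod ν) :=
  hu.integrable_of_hasCompactSupport (HasCompactSupport.of_compactSpace _)

theorem mixedPayoff_dirac_left (hu : Continuous fun p : Z × Z => u p.1 p.2) (z : Z)
    (ν : Measure Z) [IsProbabilityMeasure ν] :
    LatentGame.mixedPayoff u (Measure.dirac z) ν = ∫ w, u z w ∂ν := by
  rw [LatentGame.mixedPayoff, integral_prod _ (integrable_payoff hu _ _), integral_dirac]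

theorem mixedPayoff_dirac_right (hu : Continuous fun p : Z × Z => u p.1 p.2) (μ : Measure Z)
    [IsProbabilityMeasure μ] (w : Z) :
    LatentGame.mixedPayoff u μ (Measure.dirac w) = ∫ z, u z w ∂μ := by
  rw [LatentGame.mixedPayoff, integral_prod_symm _ (integrable_payoff hu _ _), integral_dirac]

/-- A pair whose duality gap against pure strategies is at most `ε` is an `ε`-equilibrium. -/
theorem isApproxNash_of_gap_le (hu : Continuous fun p : Z × Z => u p.1 p.2) {ε : ℝ}
    (μ ν : Measure Z) [IsProbabilityMeasure μ] [IsProbabilityMeasure ν]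
    (h : ∀ z w, ∫ w', u z w' ∂ν - ∫ z', u z' w ∂μ ≤ ε) : LatentGame.IsApproxNash u ε μ ν := by
  have avg_le : ∀ (m : Measure Z) [IsProbabilityMeasure m] (f : Z → ℝ) (c : ℝ), Integrable f m →
      (∀ z, f z ≤ c) → ∫ z, f z ∂m ≤ c := fun m _ f c hf hc => by
    simpa using integral_mono hf (integrable_const c) hc
  have le_avg : ∀ (m : Measure Z) [IsProbabilityMeasure m] (f : Z → ℝ) (c : ℝ), Integrable f m →
      (∀ z, c ≤ f z) → c ≤ ∫ z, f z ∂m := fun m _ f c hf hc => by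
    simpa using integral_mono (integrable_const c) hf hc
  have hrow : ∀ m : Measure Z, IsProbabilityMeasure m → LatentGame.mixedPayoff u m ν =
      ∫ z, ∫ w, u z w ∂ν ∂m := fun m _ => integral_prod _ (integrable_payoff hu m ν)
  have hcol : ∀ m : Measure Z, IsProbabilityMeasure m → LatentGame.mixedPayoff u μ m =
      ∫ w, ∫ z, u z w ∂μ ∂m := fun m _ => integral_prod_symm _ (integrable_payoff hu μ m)
  refine ⟨inferInstance, inferInstance, fun μ' _ => ?_, fun ν' _ => ?_⟩
  · rw [hcol ν inferInstance, hrow μ' inferInstance]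
    refine le_avg ν _ _ (integrable_payoff hu μ ν).integral_prod_right fun w => ?_
    rw [sub_le_iff_le_add]
    exact avg_le μ' _ _ (integrable_payoff hu μ' ν).integral_prod_left fun z => by
      linarith [h z w]
  · rw [hrow μ inferInstance, hcol ν' inferInstance]
    have : ∫ z, ∫ w, u z w ∂ν ∂μ ≤ ∫ w, ∫ z, u z w ∂μ ∂ν' + ε := by
      refine avg_le μ _ _ (integrable_payoff hu μ ν).integral_prod_left fun z => ?_
      rw [← sub_le_iff_le_add]
      exact le_avg ν' _ _ (integrable_payoff hu μ ν').integral_prod_right fun w => by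
        linarith [h z w]
    linarith

theorem isApproxNash_empirical (hu : Continuous fun p : Z × Z => u p.1 p.2) {x y : ℕ → Z} {T : ℕ}
    (hT : 1 ≤ T) {ε : ℝ} (h : ∀ z w, cumulativePayoff u y T z +
      cumulativePayoff (fun w z => -u z w) x T w ≤ ε * T) :
    LatentGame.IsApproxNash u ε (LatentGame.empirical x T) (LatentGame.empirical y T) := by
  have := isProbabilityMeasure_empirical x hT
  have := isProbabilityMeasure_empirical y hT
  refine isApproxNash_of_gap_le hu _ _ fun z w => ?_
  have hT' : (0 : ℝ) < T := by exact_mod_cast hT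
  rw [integral_empirical, integral_empirical, ← sub_div, div_le_iff₀ hT']
  simpa [cumulativePayoff, ← sub_eq_add_neg] using h z w

theorem LatentGame.IsApproxFictitiousPlay.isApproxResponse
    (hu : Continuous fun p : Z × Z => u p.1 p.2) {x y : ℕ → Z} {e₁ e₂ : ℕ → ℝ}
    (h : LatentGame.IsApproxFictitiousPlay u x y e₁ e₂) :
    IsApproxResponse u x y e₁ ∧ IsApproxResponse (fun w z => -u z w) y x e₂ := by
  refine ⟨⟨h.err₁_nonneg, fun t z => ?_⟩, ⟨h.err₂_nonneg, fun t z => ?_⟩⟩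
  all_goals
    rcases Nat.eq_zero_or_pos t with rfl | ht
    · simp [cumulativePayoff]
    have := isProbabilityMeasure_empirical x ht
    have := isProbabilityMeasure_empirical y ht
    have ht' : (0 : ℝ) < t := by exact_mod_cast ht
  · have h1 := h.response₁ t ht z
    rw [mixedPayoff_dirac_left hu, mixedPayoff_dirac_left hu, integral_empirical,
      integral_empirical, ge_iff_le, sub_le_iff_le_add, div_le_iff₀ ht', add_mul,
      div_mul_cancel₀ _ ht'.ne'] at h1
    simp only [cumulativePayoff]
    linarith
  · have h1 := h.response₂ t ht z
    rw [mixedPayoff_dirac_right hu, mixedPayoff_dirac_right hu, integral_empirical,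
      integral_empirical, div_le_iff₀ ht', add_mul, div_mul_cancel₀ _ ht'.ne'] at h1
    simp only [cumulativePayoff, Finset.sum_neg_distrib]
    linarith

/-! ### Existence of an equilibrium -/

/-- Limit points of the empirical distributions of exact fictitious play are equilibria. -/
theorem exists_isApproxNash_zero [Nonempty Z] (hu : Continuous fun p : Z × Z => u p.1 p.2) :
    ∃ μ ν : Measure Z, LatentGame.IsApproxNash u 0 μ ν := by
  obtain ⟨x, y, hx, hy⟩ := exists_exact_response hu
  let M : ℕ → ProbabilityMeasure Z := fun n =>
    ⟨LatentGame.empirical x (n + 1), isProbabilityMeasure_empirical x (by omega)⟩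
  let N : ℕ → ProbabilityMeasure Z := fun n =>
    ⟨LatentGame.empirical y (n + 1), isProbabilityMeasure_empirical y (by omega)⟩
  obtain ⟨U, hU⟩ : ∃ U : Ultrafilter ℕ, (U : Filter ℕ) ≤ atTop := ⟨_, Ultrafilter.of_le atTop⟩
  obtain ⟨μ, -, hμ⟩ := isCompact_univ.ultrafilter_le_nhds (U.map M) (by simp)
  obtain ⟨ν, -, hν⟩ := isCompact_univ.ultrafilter_le_nhds (U.map N) (by simp)
  have hμ' : Tendsto M U (𝓝 μ) := hμ
  have hν' : Tendsto N U (𝓝 ν) := hν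
  rw [ProbabilityMeasure.tendsto_iff_forall_integral_tendsto] at hμ' hν'
  have hu₁ : ∀ w, Continuous fun z => u z w := fun w =>
    hu.comp (continuous_id.prodMk continuous_const)
  have hu₂ : ∀ z, Continuous fun w => u z w := fun z =>
    hu.comp (continuous_const.prodMk continuous_id)
  refine ⟨μ, ν, isApproxNash_of_gap_le hu _ _ fun z w => le_of_forall_pos_le_add fun ε hε => ?_⟩
  obtain ⟨δ, hδ, T₀, hgap⟩ := exists_gap_le hu hε
  have h₁ := hν' (BoundedContinuousFunction.mkOfCompact ⟨_, hu₂ z⟩)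
  have h₂ := hμ' (BoundedContinuousFunction.mkOfCompact ⟨_, hu₁ w⟩)
  refine le_of_tendsto (h₁.sub h₂) (hU ?_)
  filter_upwards [eventually_ge_atTop T₀] with n hn
  have hT : (0 : ℝ) < ((n + 1 : ℕ) : ℝ) := by positivity
  have h := hgap x y 0 0 hx hy (n + 1) (by omega) (by simp; positivity) z w
  change ∫ w', u z w' ∂(LatentGame.empirical y (n + 1)) -
    ∫ z', u z' w ∂(LatentGame.empirical x (n + 1)) ≤ 0 + ε
  rw [integral_empirical, integral_empirical, ← sub_div, div_le_iff₀ hT, zero_add]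
  simpa [cumulativePayoff, ← sub_eq_add_neg] using h

/-! ### Long-run accuracy -/

theorem exists_isEventualAccuracy [Nonempty Z] (hu : Continuous fun p : Z × Z => u p.1 p.2) {ε : ℝ}
    (hε : 0 < ε) : ∃ δ > 0, IsEventualAccuracy u δ ε := by
  obtain ⟨δ, hδ, T₀, h⟩ := exists_gap_le hu hε
  refine ⟨δ, hδ, max T₀ 1, fun z₁ z₂ e₁ e₂ hp T hT hE => ?_⟩
  have hT1 : 1 ≤ T := (le_max_right _ _).trans hT
  have hT' : (0 : ℝ) < T := by exact_mod_cast hT1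
  obtain ⟨h₁, h₂⟩ := hp.isApproxResponse hu
  exact isApproxNash_empirical hu hT1
    (h z₁ z₂ e₁ e₂ h₁ h₂ T ((le_max_left _ _).trans hT) ((div_le_iff₀ hT').1 hE))

/-- The range of the payoff bounds what any deviation can gain. -/
theorem exists_forall_isEventualAccuracy (hu : Continuous fun p : Z × Z => u p.1 p.2) :
    ∃ ε > 0, ∀ δ, IsEventualAccuracy u δ ε := by
  obtain ⟨C, hC⟩ := exists_abs_le_of_continuous hu
  refine ⟨2 * |C| + 1, by positivity, fun δ => ⟨1, fun z₁ z₂ e₁ e₂ _ T hT _ =>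
    isApproxNash_empirical hu hT fun z w => ?_⟩⟩
  have h₁ := (abs_le.1 (abs_sub_le_of_abs_succ_sub_le (A := fun t => cumulativePayoff u z₂ t z)
    (fun t => abs_cumulativePayoff_succ_sub_le hC t z) (Nat.zero_le T))).2
  have h₂ := (abs_le.1 (abs_sub_le_of_abs_succ_sub_le
    (A := fun t => cumulativePayoff (fun w z => -u z w) z₁ t w)
    (fun t => abs_cumulativePayoff_succ_sub_le (C := C) (fun w z => by simpa using hC z w) t w)
    (Nat.zero_le T))).2
  simp only [cumulativePayoff, Finset.range_zero, Finset.sum_empty, sub_zero,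
    Nat.cast_zero] at h₁ h₂ ⊢
  have h₃ : C * (T : ℝ) ≤ |C| * T := by gcongr; exact le_abs_self C
  have h₄ : (0 : ℝ) ≤ T := by positivity
  linarith

theorem isEventualAccuracy_errorFloor_add (hu : Continuous fun p : Z × Z => u p.1 p.2) (δ : ℝ)
    {η : ℝ} (hη : 0 < η) : IsEventualAccuracy u δ (errorFloor u δ + η) := by
  obtain ⟨ε, hε, h⟩ := exists_forall_isEventualAccuracy hu
  obtain ⟨ε', ⟨-, T₀, h'⟩, hlt⟩ := exists_lt_of_csInf_lt
    (s := {ε | 0 < ε ∧ IsEventualAccuracy u δ ε}) ⟨ε, hε, h δ⟩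
    (lt_add_of_pos_right (errorFloor u δ) hη)
  exact ⟨T₀, fun z₁ z₂ e₁ e₂ hp T hT hE => (h' z₁ z₂ e₁ e₂ hp T hT hE).mono hlt.le⟩

theorem tendsto_errorFloor [Nonempty Z] (hu : Continuous fun p : Z × Z => u p.1 p.2) :
    Tendsto (errorFloor u) (𝓝[≥] 0) (𝓝 0) := by
  have hnonneg : ∀ δ, 0 ≤ errorFloor u δ := fun δ => Real.sInf_nonneg fun ε hε => hε.1.le
  refine Metric.tendsto_nhds.2 fun ε hε => ?_
  obtain ⟨δ₀, hδ₀, h⟩ := exists_isEventualAccuracy hu (half_pos hε)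
  filter_upwards [nhdsWithin_le_nhds (Iic_mem_nhds hδ₀)] with δ hδ
  rw [Real.dist_eq, sub_zero, abs_of_nonneg (hnonneg δ)]
  refine (csInf_le (s := {ε | 0 < ε ∧ IsEventualAccuracy u δ ε})
    ⟨0, fun ε' hε' => hε'.1.le⟩ ⟨half_pos hε, h.anti hδ⟩).trans_lt ?_
  linarith

end Mixed

theorem proposition1 {Z : Type*} [MetricSpace Z] [CompactSpace Z] [Nonempty Z]
    [MeasurableSpace Z] [BorelSpace Z]
    (u : Z → Z → ℝ) (hu : Continuous (fun p : Z × Z => u p.1 p.2)) :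
    -- the mixed extension is well defined
    (∀ μ ν : Measure Z, IsProbabilityMeasure μ → IsProbabilityMeasure ν →
      Integrable (fun p : Z × Z => u p.1 p.2) (μ.prod ν)) ∧
    -- the induced game has a value and a Nash equilibrium
    (∃ V : ℝ, LatentGame.IsValue u V) ∧
    (∃ μ ν : Measure Z, LatentGame.IsApproxNash u 0 μ ν) ∧
    -- convergence up to an error floor governed by the average best-response error
    (∃ ω : ℝ → ℝ, Tendsto ω (𝓝[≥] 0) (𝓝 0) ∧
      ∀ δ : ℝ, 0 ≤ δ → ∀ η : ℝ, 0 < η → ∃ T₀ : ℕ,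
        ∀ (z₁ z₂ : ℕ → Z) (e₁ e₂ : ℕ → ℝ),
          LatentGame.IsApproxFictitiousPlay u z₁ z₂ e₁ e₂ →
          ∀ T : ℕ, T₀ ≤ T → LatentGame.averageError e₁ e₂ T ≤ δ →
            LatentGame.IsApproxNash u (ω δ + η)
              (LatentGame.empirical z₁ T) (LatentGame.empirical z₂ T)) ∧
    -- convergence to equilibrium when the average errors vanish
    (∀ (z₁ z₂ : ℕ → Z) (e₁ e₂ : ℕ → ℝ),
      LatentGame.IsApproxFictitiousPlay u z₁ z₂ e₁ e₂ →
      Tendsto (LatentGame.averageError e₁ e₂) atTop (𝓝 0) →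
      ∀ ε : ℝ, 0 < ε → ∀ᶠ T : ℕ in atTop,
        LatentGame.IsApproxNash u ε
          (LatentGame.empirical z₁ T) (LatentGame.empirical z₂ T)) := by

  obtain ⟨μ, ν, hμν⟩ := exists_isApproxNash_zero hu
  refine ⟨fun μ ν _ _ => integrable_payoff hu μ ν, ⟨_, hμν.isValue⟩, ⟨μ, ν, hμν⟩,
    ⟨errorFloor u, tendsto_errorFloor hu, fun δ _ η hη =>
      isEventualAccuracy_errorFloor_add hu δ hη⟩, fun z₁ z₂ e₁ e₂ hp hE ε hε => ?_⟩
  obtain ⟨δ, hδ, T₀, h⟩ := exists_isEventualAccuracy hu hε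
  filter_upwards [eventually_ge_atTop T₀, hE.eventually_le_const hδ] with T hT hET
  exact h z₁ z₂ e₁ e₂ hp T hT hET
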